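/- For a group $G$, the Sidki double (weak commutativity group) $\mathfrak{X}(G)$ is the quotient of the free product $G * \overline{G}$, where $\overline{G}$ is a second copy of $G$ and $g \mapsto \overline{g}$ is a fixed isomorphism $G \to \overline{G}$, by the normal subgroup generated by the commutators $[g, \overline{g}]$ for all $g \in G$. If $G$ is finitely generated and virtually nilpotent (that is, $G$ has a nilpotent subgroup of finite index), then $\mathfrak{X}(G)$ is virtually nilpotent. -/

import Mathlib

/-- The normal subgroup of the free product `G ∗ G` generated by the commutators
`[x, y] = x⁻¹ y⁻¹ x y` of each element `g` of the first factor with its copy in the second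
factor. -/
def sidkiRelations (G : Type*) [Group G] : Subgroup (Monoid.Coprod G G) :=
  Subgroup.normalClosure
    (Set.range fun g : G =>
      (Monoid.Coprod.inl g : Monoid.Coprod G G)⁻¹ * (Monoid.Coprod.inr g)⁻¹ *
        Monoid.Coprod.inl g * Monoid.Coprod.inr g)

instance sidkiRelations_normal (G : Type*) [Group G] : (sidkiRelations G).Normal :=
  Subgroup.normalClosure_normal

/-- The Sidki double (weak commutativity group) of `G`: the quotient of the free product of two
copies of `G` obtained by forcing each `g` in the first factor to commute with the copy of `g` in
the second factor. -/
abbrev SidkiDouble (G : Type*) [Group G] : Type _ :=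
  Monoid.Coprod G G ⧸ sidkiRelations G

/-! Let `L` be the kernel of `fold` and `W` its intersection with the kernels of `left` and `right`.
The quotient by `W` embeds in `G × G × G`, so what matters is conjugation on `W`. By
`commute_of_mem_ker`, whatever `left` and `right` both kill centralises `L`. Hence `W` is central in
`L`, and the action on `W` factors through `G`, even through an abelian quotient, as `⁅inl a, inr
b⁆` acts trivially.

A normal nilpotent `H` of finite index acts unipotently (`exists_iterate_commutator_inl_eq_one`):
with `A = L ⊓ right.ker`, iterated commutation with `inl h` moves `W` into `⁅L, L⁆`, `⁅A, L⁆`, `⁅A,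
A⁆` and finally to `1`. Finitely many commuting unipotents generate a nilpotent action, so the
preimage of `H × H × H` is nilpotent (`Subgroup.isNilpotent_of_unipotent_action`). -/

open scoped commutatorElement

/-! ### Commuting unipotent actions -/

/-- In a ring, if a finitely generated group acts by commuting elements `ρ h` with every `ρ h - 1`
nilpotent, then sufficiently long products of elements `ρ h - 1` vanish. -/
theorem exists_list_prod_sub_one_eq_zero {H E : Type*} [Group H] [Ring E] (hH : Group.FG H)
    (ρ : H →* E) (hcomm : ∀ a b, ρ a * ρ b = ρ b * ρ a) (hnil : ∀ h, IsNilpotent (ρ h - 1)) :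
    ∃ n, ∀ l : List H, l.length = n → (l.map fun h => ρ h - 1).prod = 0 := by
  let R := Subring.closure (Set.range ρ)
  have hR : IsMulCommutative R := Subring.isMulCommutative_closure (by
    rintro _ ⟨a, rfl⟩ _ ⟨b, rfl⟩
    exact hcomm a b)
  let _ : CommRing R := { (inferInstance : Ring R) with mul_comm := fun a b => hR.is_comm.comm a b }
  let σ : H →* R := ρ.codRestrict R fun h => Subring.subset_closure ⟨h, rfl⟩
  have hσ : ∀ h, ((σ h : R) : E) = ρ h := fun h => rfl
  classical
  obtain ⟨s, hs⟩ := Group.fg_def.mp hH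
  -- An ideal generated by finitely many nilpotents of a commutative ring is nilpotent, and it
  -- already contains `σ h - 1` for every `h`.
  let I : Ideal R := Ideal.span ((fun h => σ h - 1) '' (s : Set H))
  have hmem : ∀ h, σ h - 1 ∈ I := by
    intro h
    have hh : h ∈ Subgroup.closure (s : Set H) := by rw [hs]; trivial
    induction hh using Subgroup.closure_induction with
    | mem x hx => exact Ideal.subset_span ⟨x, hx, rfl⟩
    | one => simp
    | mul x y _ _ hx hy =>
      have e : σ (x * y) - 1 = σ x * (σ y - 1) + (σ x - 1) := by rw [map_mul]; ring
      rw [e]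
      exact I.add_mem (I.mul_mem_left _ hy) hx
    | inv x _ hx =>
      have e0 : σ x⁻¹ * σ x = 1 := by rw [← map_mul]; simp
      have e : σ x⁻¹ - 1 = -σ x⁻¹ * (σ x - 1) := by linear_combination e0
      rw [e]
      exact I.mul_mem_left _ hx
  have hfg : I.FG := ⟨s.image fun h => σ h - 1, by simp [I]⟩
  have hI : IsNilpotent I := by
    rw [hfg.isNilpotent_iff_le_nilradical, Ideal.span_le]
    rintro _ ⟨h, -, rfl⟩
    obtain ⟨m, hm⟩ := hnil h
    refine ⟨m, Subtype.ext ?_⟩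
    simpa [hσ] using hm
  obtain ⟨n, hn⟩ := hI
  have hl : ∀ l : List H, (l.map fun h => σ h - 1).prod ∈ I ^ l.length := by
    intro l
    induction l with
    | nil => simp
    | cons a l ih =>
      rw [List.map_cons, List.prod_cons, List.length_cons, pow_succ']
      exact Ideal.mul_mem_mul (hmem a) ih
  refine ⟨n, fun l hln => ?_⟩
  have h0 := hl l
  rw [hln, hn] at h0
  have h1 : (l.map fun h => σ h - 1).prod = 0 := h0
  have h2 := congrArg (Subring.subtype R) h1
  rw [map_list_prod, List.map_map] at h2
  simpa [Function.comp_def, hσ] using h2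

/-- Let `W` be an abelian normal subgroup on which `N` acts through a finitely generated group `H`
acting by commuting unipotent automorphisms. If some term of the lower central series of `N` lies
in `W`, then `N` is nilpotent. -/
theorem Subgroup.isNilpotent_of_unipotent_action {X H : Type*} [Group X] [Group H]
    (hH : Group.FG H) (s : H →* X) (W : Subgroup X) [W.Normal]
    (hW : ∀ a ∈ W, ∀ b ∈ W, a * b = b * a) (N : Subgroup X) (n : ℕ)
    (hN : N.lowerCentralSeries n ≤ W)
    (hs : ∀ x ∈ N, ∃ h, ∀ w ∈ W, x * w * x⁻¹ = s h * w * (s h)⁻¹)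
    (hcomm : ∀ a b, ∀ w ∈ W, s (a * b) * w * (s (a * b))⁻¹ = s (b * a) * w * (s (b * a))⁻¹)
    (hunip : ∀ h, ∃ m, ∀ w ∈ W, (fun x => ⁅s h, x⁆)^[m] w = 1) : Group.IsNilpotent N := by
  let _ : CommGroup W :=
    { (inferInstance : Group W) with
      mul_comm := fun a b => Subtype.ext (hW a a.2 b b.2) }
  let ρ : H →* AddMonoid.End (Additive W) :=
    { toFun := fun h => MonoidHom.toAdditive (MulAut.conjNormal (s h) : W ≃* W).toMonoidHom
      map_one' := by rw [map_one, map_one]; rfl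
      map_mul' := fun a b => by rw [map_mul, map_mul]; rfl }
  have hρ : ∀ h (w : W), ((ρ h (Additive.ofMul w)).toMul : X) = s h * w * (s h)⁻¹ := fun h w => rfl
  have hρ1 : ∀ h (w : W), (((ρ h - 1) (Additive.ofMul w)).toMul : X) = ⁅s h, (w : X)⁆ := by
    intro h w
    have e : (ρ h - 1) (Additive.ofMul w) = ρ h (Additive.ofMul w) - Additive.ofMul w := rfl
    rw [commutatorElement_def, ← hρ, e, sub_eq_add_neg]
    rfl
  have hpow : ∀ h m (w : W), ((((ρ h - 1) ^ m) (Additive.ofMul w)).toMul : X) =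
      (fun x => ⁅s h, x⁆)^[m] (w : X) := by
    intro h m
    induction m with
    | zero => intro w; rfl
    | succ m ih =>
      intro w
      rw [Function.iterate_succ_apply, ← hρ1, ← ih, pow_succ]
      rfl
  obtain ⟨M, hM⟩ := exists_list_prod_sub_one_eq_zero hH ρ
    (fun a b => by
      rw [← map_mul, ← map_mul]
      ext w
      exact hcomm a b _ w.toMul.2)
    (fun h => by
      obtain ⟨m, hm⟩ := hunip h
      refine ⟨m, ?_⟩
      ext w
      exact (hpow h m w.toMul).trans (hm _ w.toMul.2))
  -- `Z j` is the part of `W` killed by all `j`-fold products: `Z M` is `W`, `Z 0` is trivial, and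
  -- commutation with `N` lowers the index.
  let Z : ℕ → Subgroup X := fun j => Subgroup.map W.subtype
    { carrier := {w | ∀ l : List H, l.length = j →
        (l.map fun h => ρ h - 1).prod (Additive.ofMul w) = 0}
      one_mem' := fun l _ => by rw [ofMul_one, map_zero]
      mul_mem' := fun {a b} ha hb l hl => by rw [ofMul_mul, map_add, ha l hl, hb l hl, add_zero]
      inv_mem' := fun {a} ha l hl => by rw [ofMul_inv, map_neg, ha l hl, neg_zero] }
  have key : ∀ j i, i + j = M → N.lowerCentralSeries (n + j) ≤ Z i := by
    intro j
    induction j with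
    | zero =>
      intro i hi x hx
      refine ⟨⟨x, hN hx⟩, fun l hl => ?_, rfl⟩
      rw [hM l (by omega)]
      rfl
    | succ j ih =>
      intro i hi
      rw [← add_assoc, Subgroup.lowerCentralSeries_succ, Subgroup.commutator_le]
      intro x hx y hy
      obtain ⟨w, hw, rfl⟩ := ih (i + 1) (by omega) hx
      obtain ⟨h, hh⟩ := hs y hy
      rw [← commutatorElement_inv]
      refine inv_mem ⟨((ρ h - 1) (Additive.ofMul w)).toMul, fun l hl => ?_, ?_⟩
      · have := hw (l ++ [h]) (by simp [hl])
        rw [List.map_append, List.prod_append] at this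
        simpa using this
      · exact (hρ1 h w).trans (by
          rw [commutatorElement_def, commutatorElement_def, ← hh w w.2]
          rfl)
  refine Subgroup.isNilpotent_of_lowerCentralSeries_eq_bot (n := n + M) ?_
  rw [eq_bot_iff]
  intro x hx
  obtain ⟨w, hw, rfl⟩ := key M 0 (by omega) hx
  have h0 : Additive.ofMul w = 0 := hw [] rfl
  have h1 : w = 1 := h0
  rw [h1]
  exact one_mem _

/-! ### Iterated commutators modulo normal subgroups -/

/-- Iterated commutation with `k` on an abelian section `M / N`: it suffices to check that it ends
in `N` on generators. -/
theorem iterate_commutator_mem_of_mem_closure {X : Type*} [Group X] (N M : Subgroup X) [N.Normal]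
    [M.Normal] (hMN : ⁅M, M⁆ ≤ N) (k : X) (m : ℕ) {S : Set X} (hS : S ⊆ M)
    (h : ∀ x ∈ S, (fun x => ⁅k, x⁆)^[m] x ∈ N) {x : X} (hx : x ∈ Subgroup.closure S) :
    (fun x => ⁅k, x⁆)^[m] x ∈ N := by
  have hM : ∀ x ∈ M, ⁅k, x⁆ ∈ M := fun x hx => by
    rw [commutatorElement_def]
    exact M.mul_mem (‹M.Normal›.conj_mem x hx k) (M.inv_mem hx)
  let π := QuotientGroup.mk' N
  have hπ : ∀ x, π x = 1 ↔ x ∈ N := fun x => QuotientGroup.eq_one_iff x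
  have hab : ∀ x ∈ M, ∀ y ∈ M, π x * π y = π y * π x := by
    intro x hx y hy
    rw [← commutatorElement_eq_one_iff_mul_comm, ← map_commutatorElement, hπ]
    exact hMN (Subgroup.commutator_mem_commutator hx hy)
  -- Commutation with `k` is additive on the abelian image of `M`.
  have step : ∀ x ∈ M, ∀ y ∈ M, ∀ z, π z = π x * π y → π ⁅k, z⁆ = π ⁅k, x⁆ * π ⁅k, y⁆ := by
    intro x hx y hy z hz
    have h1 := hab x⁻¹ (M.inv_mem hx) _ (hM y hy)
    simp only [commutatorElement_def, map_mul, map_inv, hz] at h1 ⊢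
    calc π k * (π x * π y) * (π k)⁻¹ * (π x * π y)⁻¹
        = π k * π x * (π k)⁻¹ * (π k * π y * (π k)⁻¹ * (π y)⁻¹ * (π x)⁻¹) := by group
      _ = _ := by rw [← h1]; group
  have iter : ∀ m, ∀ x ∈ M, ∀ y ∈ M, ∀ z ∈ M, π z = π x * π y →
      π ((fun x => ⁅k, x⁆)^[m] z) =
        π ((fun x => ⁅k, x⁆)^[m] x) * π ((fun x => ⁅k, x⁆)^[m] y) := by
    intro m
    induction m with
    | zero => exact fun x _ y _ z _ h => h
    | succ m ih =>
      intro x hx y hy z hz h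
      simp only [Function.iterate_succ_apply]
      exact ih _ (hM x hx) _ (hM y hy) _ (hM z hz) (step x hx y hy z h)
  have h1 : π ((fun x => ⁅k, x⁆)^[m] 1) = 1 := by
    have := iter m 1 M.one_mem 1 M.one_mem 1 M.one_mem (by simp)
    simpa using this
  have hSM : Subgroup.closure S ≤ M := (Subgroup.closure_le M).mpr hS
  rw [← hπ]
  induction hx using Subgroup.closure_induction with
  | mem x hx => exact (hπ _).mpr (h x hx)
  | one => exact h1
  | mul x y hx hy ihx ihy =>
    rw [iter m x (hSM hx) y (hSM hy) _ (M.mul_mem (hSM hx) (hSM hy)) (map_mul π x y), ihx, ihy,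
      one_mul]
  | inv x hx ihx =>
    have := iter m x (hSM hx) x⁻¹ (M.inv_mem (hSM hx)) 1 M.one_mem (by simp)
    rwa [h1, ihx, one_mul, eq_comm] at this

/-- If `k` centralises `L` modulo `A`, then modulo `⁅A, A⁆` iterated commutation of `⁅a, l⁆` with
`k` takes place in the first entry. -/
theorem iterate_commutator_commutator_mem {X : Type*} [Group X] (A L : Subgroup X) [A.Normal]
    [L.Normal] (hAL : A ≤ L) (k : X) (hk : ∀ l ∈ L, ⁅k, l⁆ ∈ A) (m : ℕ) {a l : X} (ha : a ∈ A)
    (hl : l ∈ L) (h : ⁅(fun x => ⁅k, x⁆)^[m] a, l⁆ ∈ ⁅A, A⁆) :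
    (fun x => ⁅k, x⁆)^[m] ⁅a, l⁆ ∈ ⁅A, A⁆ := by
  let π := QuotientGroup.mk' ⁅A, A⁆
  have hπ : ∀ x, π x = 1 ↔ x ∈ ⁅A, A⁆ := fun x => QuotientGroup.eq_one_iff x
  have hab : ∀ x ∈ A, ∀ y ∈ A, π x * π y = π y * π x := by
    intro x hx y hy
    rw [← commutatorElement_eq_one_iff_mul_comm, ← map_commutatorElement, hπ]
    exact Subgroup.commutator_mem_commutator hx hy
  -- Conjugation by `k` sends `a` to `b * a` and `l` to `c * l` with `b`, `c` in `A`; modulo `⁅A,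
  -- A⁆` the factor `c` drops out and `⁅b, l⁆` splits off.
  have step : ∀ a ∈ A, ∀ z, π z = π ⁅a, l⁆ → π ⁅k, z⁆ = π ⁅⁅k, a⁆, l⁆ := by
    intro a ha z hz
    have hb := hk a (hAL ha)
    have hc := hk l hl
    have hkl : π k * π l * (π k)⁻¹ = π ⁅k, l⁆ * π l := by
      simp [commutatorElement_def]
    have hka : π k * π a * (π k)⁻¹ = π ⁅k, a⁆ * π a := by
      simp [commutatorElement_def]
    have hconj : ∀ x ∈ A, l * x * l⁻¹ ∈ A := fun x hx => ‹A.Normal›.conj_mem x hx l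
    have c1 := hab _ hc _ (A.mul_mem (A.mul_mem hb ha)
      (hconj _ (A.inv_mem (A.mul_mem hb ha))))
    have c2 := hab _ (A.mul_mem ha (hconj _ (A.inv_mem ha))) _ (hconj _ (A.inv_mem hb))
    rw [map_commutatorElement, hz, map_commutatorElement, map_commutatorElement]
    generalize ⁅k, l⁆ = c at *
    generalize ⁅k, a⁆ = b at *
    simp only [map_mul, map_inv] at c1 c2
    calc ⁅π k, ⁅π a, π l⁆⁆
        = ⁅π k * π a * (π k)⁻¹, π k * π l * (π k)⁻¹⁆ * ⁅π a, π l⁆⁻¹ := by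
          simp only [commutatorElement_def]; group
      _ = ⁅π b * π a, π c * π l⁆ * ⁅π a, π l⁆⁻¹ := by rw [hka, hkl]
      _ = (π b * π a * π c * (π b * π a)⁻¹ * (π c)⁻¹) * (π c *
            (π b * π a * (π l * (π b * π a)⁻¹ * (π l)⁻¹)) * (π c)⁻¹) * ⁅π a, π l⁆⁻¹ := by
          simp only [commutatorElement_def]; group
      _ = (π b * π a * (π l * (π b * π a)⁻¹ * (π l)⁻¹)) * ⁅π a, π l⁆⁻¹ := by
          have c3 := hab _ (A.mul_mem hb ha) _ hc
          rw [c1]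
          simp only [map_mul] at c3
          rw [c3]
          group
      _ = π b * ((π a * (π l * (π a)⁻¹ * (π l)⁻¹)) * (π l * (π b)⁻¹ * (π l)⁻¹)) *
            ⁅π a, π l⁆⁻¹ := by
          group
      _ = ⁅π b, π l⁆ := by
          rw [c2]
          simp only [commutatorElement_def]; group
  have iter : ∀ m, ∀ a ∈ A, ∀ z, π z = π ⁅a, l⁆ →
      π ((fun x => ⁅k, x⁆)^[m] z) = π ⁅(fun x => ⁅k, x⁆)^[m] a, l⁆ := by
    intro m
    induction m with
    | zero => exact fun a _ z h => h
    | succ m ih =>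
      intro a ha z hz
      simp only [Function.iterate_succ_apply]
      exact ih _ (hk a (hAL ha)) _ (step a ha z hz)
  rw [← hπ, iter m a ha _ rfl, hπ]
  exact h

/-- Factors that commute with everything in sight do not change a commutator. -/
theorem commutatorElement_mul_mul_of_commute {X : Type*} [Group X] {a b y z : X}
    (hya : Commute y a) (hyb : Commute y b) (hyz : Commute y z) (hza : Commute z a)
    (hzb : Commute z b) : ⁅y * a, z * b⁆ = ⁅a, b⁆ := by
  have h : ∀ {u : X}, Commute u a → Commute u b → Commute u ⁅a, b⁆ := fun ha hb =>
    ((ha.mul_right hb).mul_right ha.inv_right).mul_right hb.inv_right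
  have e : ⁅y * a, z * b⁆ = y * (a * z) * b * a⁻¹ * (y⁻¹ * (z * b)⁻¹) := by
    rw [commutatorElement_def]; group
  rw [e, (hyz.mul_right hyb).inv_inv.eq, ← hza.eq]
  calc y * (z * a) * b * a⁻¹ * ((z * b)⁻¹ * y⁻¹) = y * (z * ⁅a, b⁆ * z⁻¹) * y⁻¹ := by
        rw [commutatorElement_def]; group
    _ = ⁅a, b⁆ := by
        rw [(h hza hzb).eq, mul_inv_cancel_right, (h hya hyb).eq, mul_inv_cancel_right]

/-- If `k` centralises `L` modulo `A`, then it centralises `⁅L, L⁆` modulo `⁅A, L⁆`. -/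
theorem commutator_mem_of_mem_commutator {X : Type*} [Group X] (A L : Subgroup X) [A.Normal]
    [L.Normal] (k : X) (hk : ∀ l ∈ L, ⁅k, l⁆ ∈ A) {x : X} (hx : x ∈ ⁅L, L⁆) :
    ⁅k, x⁆ ∈ ⁅A, L⁆ := by
  let π := QuotientGroup.mk' ⁅A, L⁆
  have hπ : ∀ x, π x = 1 ↔ x ∈ ⁅A, L⁆ := fun x => QuotientGroup.eq_one_iff x
  have hab : ∀ x ∈ A, ∀ y ∈ L, Commute (π x) (π y) := by
    intro x hx y hy
    rw [commute_iff_eq, ← commutatorElement_eq_one_iff_mul_comm, ← map_commutatorElement, hπ]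
    exact Subgroup.commutator_mem_commutator hx hy
  suffices ⁅L, L⁆ ≤ (Subgroup.centralizer {π k}).comap π by
    have h := Subgroup.mem_centralizer_singleton_iff.mp (this hx)
    rw [← hπ, map_commutatorElement, commutatorElement_eq_one_iff_mul_comm]
    first | exact h | exact h.symm
  rw [Subgroup.commutator_le]
  intro x hx y hy
  rw [Subgroup.mem_comap, Subgroup.mem_centralizer_singleton_iff]
  suffices π k * π ⁅x, y⁆ * (π k)⁻¹ = π ⁅x, y⁆ by
    have h := mul_inv_eq_iff_eq_mul.mp this
    first | exact h | exact h.symm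
  have hkx : π k * π x * (π k)⁻¹ = π ⁅k, x⁆ * π x := by
    simp [commutatorElement_def]
  have hky : π k * π y * (π k)⁻¹ = π ⁅k, y⁆ * π y := by
    simp [commutatorElement_def]
  have e : π k * π ⁅x, y⁆ * (π k)⁻¹ = ⁅π ⁅k, x⁆ * π x, π ⁅k, y⁆ * π y⁆ := by
    rw [← hkx, ← hky, map_commutatorElement]
    simp only [commutatorElement_def]; group
  have e' : π ⁅x, y⁆ = ⁅π x, π y⁆ := map_commutatorElement ..
  rw [e, e']
  have hyL : ⁅k, y⁆ ∈ L := by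
    rw [commutatorElement_def]
    exact L.mul_mem (‹L.Normal›.conj_mem y hy k) (L.inv_mem hy)
  exact commutatorElement_mul_mul_of_commute (hab _ (hk x hx) x hx) (hab _ (hk x hx) y hy)
    (hab _ (hk x hx) _ hyL) (hab _ (hk y hy) x hx) (hab _ (hk y hy) y hy)

/-! ### The Sidki double and the kernel of `fold` -/

namespace SidkiDouble

section

variable {G : Type*} [Group G]

/-- The first copy of `G` in its Sidki double. -/
def inl : G →* SidkiDouble G := (QuotientGroup.mk' (sidkiRelations G)).comp Monoid.Coprod.inl

/-- The second copy of `G` in its Sidki double. -/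
def inr : G →* SidkiDouble G := (QuotientGroup.mk' (sidkiRelations G)).comp Monoid.Coprod.inr

theorem commute_inl_inr (g : G) : Commute (inl g) (inr g) := by
  have h : (Monoid.Coprod.inl g : Monoid.Coprod G G)⁻¹ * (Monoid.Coprod.inr g)⁻¹ *
      Monoid.Coprod.inl g * Monoid.Coprod.inr g ∈ sidkiRelations G :=
    Subgroup.subset_normalClosure ⟨g, rfl⟩
  have h1 : (inl g)⁻¹ * (inr g)⁻¹ * inl g * inr g = 1 := (QuotientGroup.eq_one_iff _).mpr h
  rw [commute_iff_eq, ← mul_left_cancel_iff (a := (inl g)⁻¹ * (inr g)⁻¹), ← mul_assoc, h1]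
  group

theorem hom_ext {P : Type*} [Group P] {f f' : SidkiDouble G →* P}
    (h₁ : ∀ g, f (inl g) = f' (inl g)) (h₂ : ∀ g, f (inr g) = f' (inr g)) : f = f' :=
  QuotientGroup.monoidHom_ext _ (Monoid.Coprod.hom_ext (MonoidHom.ext h₁) (MonoidHom.ext h₂))

/-- The homomorphism out of the Sidki double given by two homomorphisms with commuting values. -/
def lift {P : Type*} [Group P] (f₁ f₂ : G →* P) (h : ∀ g, Commute (f₁ g) (f₂ g)) :
    SidkiDouble G →* P :=
  QuotientGroup.lift (sidkiRelations G) (Monoid.Coprod.lift f₁ f₂) (by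
    rw [sidkiRelations]
    refine Subgroup.normalClosure_le_normal (N := (Monoid.Coprod.lift f₁ f₂).ker) ?_
    rintro _ ⟨g, rfl⟩
    rw [SetLike.mem_coe, MonoidHom.mem_ker]
    simp only [map_mul, map_inv, Monoid.Coprod.lift_apply_inl, Monoid.Coprod.lift_apply_inr]
    rw [mul_assoc, (h g).eq]
    group)

/-- The homomorphism that identifies both copies of `G` with `G`. -/
def fold : SidkiDouble G →* G := lift (MonoidHom.id G) (MonoidHom.id G) fun g => Commute.refl g

/-- The projection to the first copy of `G` that kills the second. -/
def left : SidkiDouble G →* G := lift (MonoidHom.id G) 1 fun g => Commute.one_right g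

/-- The projection to the second copy of `G` that kills the first. -/
def right : SidkiDouble G →* G := lift 1 (MonoidHom.id G) fun g => Commute.one_left g

@[simp] theorem fold_inl (g : G) : fold (inl g) = g := rfl
@[simp] theorem fold_inr (g : G) : fold (inr g) = g := rfl
@[simp] theorem left_inl (g : G) : left (inl g) = g := rfl
@[simp] theorem left_inr (g : G) : left (inr g) = 1 := rfl
@[simp] theorem right_inl (g : G) : right (inl g) = 1 := rfl
@[simp] theorem right_inr (g : G) : right (inr g) = g := rfl

theorem inr_mul_inv_mem_ker_fold (g : G) : inr g * (inl g)⁻¹ ∈ (fold (G := G)).ker := by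
  simp [MonoidHom.mem_ker]

/-- The kernel of `fold` is generated by the elements `inr g * (inl g)⁻¹`. -/
theorem ker_fold_eq_closure :
    (fold (G := G)).ker = Subgroup.closure (Set.range fun g : G => inr g * (inl g)⁻¹) := by
  set C := Subgroup.closure (Set.range fun g : G => inr g * (inl g)⁻¹) with hC
  have hS : ∀ g, inr g * (inl g)⁻¹ ∈ C := fun g => Subgroup.subset_closure ⟨g, rfl⟩
  -- With `d g = inr g * (inl g)⁻¹`, the conjugate of `d g` by `inl k` is `(d k)⁻¹ * d (k * g)`.
  have hconj : ∀ k : G, ∀ x ∈ C, inl k * x * (inl k)⁻¹ ∈ C := by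
    intro k x hx
    rw [hC] at hx
    induction hx using Subgroup.closure_induction with
    | mem x hx =>
      obtain ⟨g, rfl⟩ := hx
      have h := C.mul_mem (C.inv_mem (hS k)) (hS (k * g))
      convert h using 1
      simp only [map_mul]
      group
    | one => simp
    | mul x y _ _ hx hy =>
      convert C.mul_mem hx hy using 1
      group
    | inv x _ hx =>
      convert C.inv_mem hx using 1
      group
  have hmul : ∀ x y : SidkiDouble G, x * (inl (fold x))⁻¹ ∈ C → y * (inl (fold y))⁻¹ ∈ C →
      x * y * (inl (fold (x * y)))⁻¹ ∈ C := by
    intro x y hx hy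
    convert C.mul_mem hx (hconj (fold x) _ hy) using 1
    simp only [map_mul]
    group
  have key : ∀ x : Monoid.Coprod G G,
      QuotientGroup.mk' (sidkiRelations G) x *
        (inl (fold (QuotientGroup.mk' (sidkiRelations G) x)))⁻¹ ∈ C := by
    intro x
    induction x using Monoid.Coprod.induction_on with
    | inl g =>
      change inl g * (inl g)⁻¹ ∈ C
      rw [mul_inv_cancel]
      exact C.one_mem
    | inr g => exact hS g
    | mul x y hx hy =>
      rw [map_mul]
      exact hmul _ _ hx hy
  apply le_antisymm
  · intro x hx
    obtain ⟨y, rfl⟩ := QuotientGroup.mk'_surjective _ x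
    have := key y
    rwa [MonoidHom.mem_ker.mp hx, map_one, inv_one, mul_one] at this
  · rw [hC, Subgroup.closure_le]
    rintro _ ⟨g, rfl⟩
    exact inr_mul_inv_mem_ker_fold g

/-- This is the relation for a product `x * y`, simplified by those for `x` and `y`. -/
theorem commutator_inr_inl (x y : G) :
    ⁅(inr x : SidkiDouble G), inl y⁆ = ⁅(inl x : SidkiDouble G), inr y⁆ := by
  have h : ∀ x y : G, (inr x : SidkiDouble G)⁻¹ * inl y * inr x * (inl y)⁻¹ =
      (inl x)⁻¹ * inr y * inl x * (inr y)⁻¹ := by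
    intro x y
    have h1 := (commute_inl_inr x).inv_left.eq
    have h2 := (commute_inl_inr y).inv_left.eq
    have h3 := (commute_inl_inr (x * y)).eq
    simp only [map_mul] at h3
    have h4 : (inl y : SidkiDouble G) * inr x * inr y =
        (inl x)⁻¹ * inr x * inr y * inl x * inl y := by
      rw [eq_comm, ← mul_right_inj (inl x)]
      simpa [mul_assoc] using h3.symm
    rw [h1] at h4
    calc (inr x : SidkiDouble G)⁻¹ * inl y * inr x * (inl y)⁻¹
        = (inr x)⁻¹ * (inl y * inr x * inr y) * ((inr y)⁻¹ * (inl y)⁻¹) := by group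
      _ = (inl x)⁻¹ * inr y * inl x * (inl y * (inr y)⁻¹ * (inl y)⁻¹) := by rw [h4]; group
      _ = (inl x)⁻¹ * inr y * inl x * (inr y)⁻¹ := by
        rw [(commute_inl_inr y).inv_right.eq, mul_inv_cancel_right]
  simpa [commutatorElement_def] using h x⁻¹ y

/-- Expanding `commutator_inr_inl` at `z * x` shows that `inl z` and `inr z` conjugate each `⁅inl x,
inr y⁆` alike, so these commutators centralise `L`. Modulo the centraliser of `L` the two copies of
`G` therefore commute, and the quotient map factors through `left.prod right`. -/
theorem commute_of_mem_ker {l d : SidkiDouble G} (hl : l ∈ (fold (G := G)).ker)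
    (h₁ : left d = 1) (h₂ : right d = 1) : Commute l d := by
  have hconj : ∀ z x y : G, inl z * ⁅(inl x : SidkiDouble G), inr y⁆ * (inl z)⁻¹ =
      inr z * ⁅(inl x : SidkiDouble G), inr y⁆ * (inr z)⁻¹ := by
    intro z x y
    have e := commutator_inr_inl (z * x) y
    have e1 : ⁅(inl (z * x) : SidkiDouble G), inr y⁆ =
        inl z * ⁅(inl x : SidkiDouble G), inr y⁆ * (inl z)⁻¹ * ⁅inl z, inr y⁆ := by
      simp only [commutatorElement_def, map_mul]; group
    have e2 : ⁅(inr (z * x) : SidkiDouble G), inl y⁆ =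
        inr z * ⁅(inr x : SidkiDouble G), inl y⁆ * (inr z)⁻¹ * ⁅inr z, inl y⁆ := by
      simp only [commutatorElement_def, map_mul]; group
    rw [e1, e2, commutator_inr_inl, commutator_inr_inl] at e
    exact (mul_right_cancel e).symm
  let Z := Subgroup.centralizer ((fold (G := G)).ker : Set (SidkiDouble G))
  have hcomm : ∀ x y : G, ⁅(inl x : SidkiDouble G), inr y⁆ ∈ Z := by
    intro x y
    rw [Subgroup.mem_centralizer_iff]
    suffices (fold (G := G)).ker ≤ Subgroup.centralizer {⁅(inl x : SidkiDouble G), inr y⁆} from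
      fun l hl => Subgroup.mem_centralizer_singleton_iff.mp (this hl)
    rw [ker_fold_eq_closure, Subgroup.closure_le]
    rintro _ ⟨z, rfl⟩
    rw [SetLike.mem_coe, Subgroup.mem_centralizer_singleton_iff]
    have := hconj z⁻¹ x y
    simp only [map_inv, inv_inv] at this
    have h5 : (inl z)⁻¹ * ⁅(inl x : SidkiDouble G), inr y⁆ =
        (inr z)⁻¹ * ⁅inl x, inr y⁆ * inr z * (inl z)⁻¹ := by
      rw [← this]; group
    rw [mul_assoc, h5]
    group
  have hcomm' : ∀ x y : G, Commute ((QuotientGroup.mk' Z).comp inl x)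
      ((QuotientGroup.mk' Z).comp inr y) := by
    intro x y
    rw [commute_iff_eq, ← commutatorElement_eq_one_iff_mul_comm]
    exact (QuotientGroup.eq_one_iff _).mpr (hcomm x y)
  have hmk : QuotientGroup.mk' Z =
      (MonoidHom.noncommCoprod _ _ hcomm').comp (left.prod right) :=
    hom_ext (fun g => by simp) (fun g => by simp)
  have hd : d ∈ Z := by
    rw [← QuotientGroup.eq_one_iff]
    change QuotientGroup.mk' Z d = 1
    rw [hmk]
    simp [h₁, h₂]
  exact Subgroup.mem_centralizer_iff.mp hd l hl

/-! ### Unipotency of the action -/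

/-- On the kernel of `fold`, conjugation by `inl k` is modulo commutators unipotent of degree
two. -/
theorem commutator_commutator_inl_mem (k : G) {x : SidkiDouble G} (hx : x ∈ (fold (G := G)).ker) :
    (fun x => ⁅inl k, x⁆)^[2] x ∈ ⁅(fold (G := G)).ker, (fold (G := G)).ker⁆ := by
  rw [ker_fold_eq_closure] at hx
  refine iterate_commutator_mem_of_mem_closure _ (fold (G := G)).ker le_rfl (inl k) 2 ?_ ?_ hx
  · rintro _ ⟨g, rfl⟩
    exact inr_mul_inv_mem_ker_fold g
  rintro _ ⟨g, rfl⟩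
  let d : G → SidkiDouble G := fun g => inr g * (inl g)⁻¹
  have hd : ∀ g, d g ∈ (fold (G := G)).ker := inr_mul_inv_mem_ker_fold
  -- `v` is `⁅inl k, d g⁆` with factors reordered modulo commutators, chosen to commute with `inl
  -- k`.
  let v := (d k)⁻¹ * ((d g)⁻¹ * d (k * g))
  have hv : Commute (inl k) v := by
    have h1 : Commute (inl k) (d k) :=
      (commute_inl_inr k).mul_right (Commute.refl (inl k)).inv_right
    have h2 : Commute (inl k) ((d g)⁻¹ * d (k * g)) := by
      have h3 := ((commute_inl_inr (g⁻¹ * k * g)).conj (inl g)).mul_right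
        (Commute.refl _).inv_right
      have e1 : inl g * inl (g⁻¹ * k * g) * (inl g)⁻¹ = (inl k : SidkiDouble G) := by
        simp only [map_mul, map_inv]; group
      have e2 : (d g)⁻¹ * d (k * g) = inl g * inr (g⁻¹ * k * g) * (inl g)⁻¹ * (inl k)⁻¹ := by
        simp only [d, map_mul, map_inv]; group
      rw [e1] at h3
      rwa [e2]
    exact h1.inv_right.mul_right h2
  have hc : ⁅(d (k * g))⁻¹, d g⁆ ∈ ⁅(fold (G := G)).ker, (fold (G := G)).ker⁆ :=
    Subgroup.commutator_mem_commutator (inv_mem (hd _)) (hd g)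
  have h1 : ⁅inl k, d g⁆ = v * ⁅(d (k * g))⁻¹, d g⁆ := by
    simp only [v, d, commutatorElement_def, map_mul]; group
  change ⁅inl k, ⁅inl k, d g⁆⁆ ∈ _
  rw [h1]
  have h2 : ⁅inl k, v * ⁅(d (k * g))⁻¹, d g⁆⁆ =
      v * (inl k * ⁅(d (k * g))⁻¹, d g⁆ * (inl k)⁻¹ * ⁅(d (k * g))⁻¹, d g⁆⁻¹) * v⁻¹ := by
    generalize ⁅(d (k * g))⁻¹, d g⁆ = c
    rw [commutatorElement_def, ← mul_assoc, hv.eq]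
    group
  rw [h2]
  exact Subgroup.Normal.conj_mem inferInstance _
    (mul_mem (Subgroup.Normal.conj_mem inferInstance _ hc _) (inv_mem hc)) _

/-- The elements of a normal nilpotent subgroup act unipotently on the intersection of the kernels
of `fold`, `left` and `right`. -/
theorem exists_iterate_commutator_inl_eq_one (H : Subgroup G) [H.Normal] [Group.IsNilpotent H]
    {h : G} (hh : h ∈ H) :
    ∃ m, ∀ w ∈ (fold (G := G)).ker ⊓ (left.ker ⊓ right.ker),
      (fun x => ⁅inl h, x⁆)^[m] w = 1 := by
  set L := (fold (G := G)).ker with hL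
  set A := L ⊓ (right (G := G)).ker with hA
  obtain ⟨c, hc⟩ := (Subgroup.isNilpotent_iff_lowerCentralSeries H).mp inferInstance
  have hcentral : ∀ w ∈ A, left w = 1 → ∀ l ∈ L, Commute l w :=
    fun w hw hw' l hl => commute_of_mem_ker hl hw' hw.2
  have hk : ∀ l ∈ L, ⁅inl h, l⁆ ∈ A := by
    intro l hl
    refine ⟨?_, ?_⟩
    · rw [commutatorElement_def]
      exact L.mul_mem (Subgroup.Normal.conj_mem inferInstance l hl _) (L.inv_mem hl)
    · simp [commutatorElement_def]
  -- The extra iteration is needed to bring `left a` into `H`, which is term `0` of the series.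
  have hiter : ∀ j, ∀ a ∈ A, (fun x => ⁅inl h, x⁆)^[j + 1] a ∈ A ∧
      left ((fun x => ⁅inl h, x⁆)^[j + 1] a) ∈ H.lowerCentralSeries j := by
    intro j a ha
    induction j with
    | zero =>
      refine ⟨hk a ha.1, ?_⟩
      change left ⁅inl h, a⁆ ∈ H
      rw [map_commutatorElement, left_inl, commutatorElement_def, mul_assoc, mul_assoc,
        ← mul_assoc (left a)]
      exact H.mul_mem hh (Subgroup.Normal.conj_mem inferInstance _ (H.inv_mem hh) _)
    | succ j ih =>
      rw [Function.iterate_succ_apply']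
      refine ⟨hk _ ih.1.1, ?_⟩
      rw [map_commutatorElement, left_inl, Subgroup.lowerCentralSeries_succ,
        Subgroup.commutator_comm]
      exact Subgroup.commutator_mem_commutator hh ih.2
  have hAL : ∀ x ∈ ⁅A, L⁆, (fun x => ⁅inl h, x⁆)^[c + 1] x ∈ ⁅A, A⁆ := by
    intro x hx
    rw [Subgroup.commutator_def] at hx
    refine iterate_commutator_mem_of_mem_closure _ A le_rfl (inl h) (c + 1) ?_ ?_ hx
    · rintro _ ⟨a, ha, l, hl, rfl⟩
      exact Subgroup.commutator_le_left A L (Subgroup.commutator_mem_commutator ha hl)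
    · rintro _ ⟨a, ha, l, hl, rfl⟩
      refine iterate_commutator_commutator_mem A L inf_le_left (inl h) hk (c + 1) ha hl ?_
      obtain ⟨h1, h2⟩ := hiter c a ha
      rw [hc, Subgroup.mem_bot] at h2
      rw [commutatorElement_eq_one_iff_mul_comm.mpr (hcentral _ h1 h2 l hl).symm.eq]
      exact one_mem _
  -- On `W`, `inl h` acts as `inr h`, and the latter fixes `⁅A, A⁆` since it changes elements of `A`
  -- only by factors centralising `L`.
  have hAA : ∀ w ∈ ⁅A, A⁆, left w = 1 → ⁅inl h, w⁆ = 1 := by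
    intro w hw hw1
    have hwA : w ∈ A := Subgroup.commutator_le_left A A hw
    have h1 : Commute (inr h) w := by
      suffices ⁅A, A⁆ ≤ Subgroup.centralizer {inr h} from
        (Subgroup.mem_centralizer_singleton_iff.mp (this hw)).symm
      rw [Subgroup.commutator_le]
      intro a ha b hb
      have hz : ∀ a ∈ A, ⁅inr h, a⁆ ∈ A ∧ left ⁅inr h, a⁆ = 1 := by
        intro a ha
        refine ⟨?_, by simp [commutatorElement_def]⟩
        rw [commutatorElement_def]
        exact A.mul_mem (Subgroup.Normal.conj_mem inferInstance a ha _) (A.inv_mem ha)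
      have hconj : ∀ a, inr h * a * (inr h)⁻¹ = ⁅inr h, a⁆ * a := fun a => by
        rw [commutatorElement_def, inv_mul_cancel_right]
      have hc : ∀ a ∈ A, ∀ l ∈ L, Commute ⁅inr h, a⁆ l := fun a ha l hl =>
        (hcentral _ (hz a ha).1 (hz a ha).2 l hl).symm
      have e : inr h * ⁅a, b⁆ * (inr h)⁻¹ = ⁅a, b⁆ := calc
        inr h * ⁅a, b⁆ * (inr h)⁻¹ = ⁅inr h * a * (inr h)⁻¹, inr h * b * (inr h)⁻¹⁆ := by
          simp only [commutatorElement_def]; group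
        _ = ⁅a, b⁆ := by
          rw [hconj, hconj]
          exact commutatorElement_mul_mul_of_commute (hc a ha a ha.1) (hc a ha b hb.1)
            (hc a ha _ (hz b hb).1.1) (hc b hb a ha.1) (hc b hb b hb.1)
      rw [Subgroup.mem_centralizer_singleton_iff]
      exact (mul_inv_eq_iff_eq_mul.mp e).symm
    have h2 : Commute (inr h * (inl h)⁻¹) w :=
      hcentral w hwA hw1 _ (inr_mul_inv_mem_ker_fold h)
    have h3 : Commute (inl h) w := by
      have := h2.inv_left.mul_left h1
      simpa using this
    exact commutatorElement_eq_one_iff_mul_comm.mpr h3.eq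
  -- Read from the right: `2` steps to `⁅L, L⁆`, `1` to `⁅A, L⁆`, `c + 1` to `⁅A, A⁆`, `1` to the
  -- identity.
  refine ⟨1 + ((c + 1) + (1 + 2)), fun w hw => ?_⟩
  have hleft : ∀ m, left ((fun x => ⁅inl h, x⁆)^[m] w) = 1 := by
    intro m
    induction m with
    | zero => exact hw.2.1
    | succ m ih =>
      rw [Function.iterate_succ_apply', map_commutatorElement, ih, commutatorElement_one_right]
  rw [Function.iterate_add_apply]
  refine hAA _ ?_ (hleft _)
  rw [Function.iterate_add_apply]
  refine hAL _ ?_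
  rw [Function.iterate_add_apply]
  exact commutator_mem_of_mem_commutator A L (inl h) hk (commutator_commutator_inl_mem h hw.1)

/-! ### Virtual nilpotency -/

theorem isVirtuallyNilpotent (hfg : Group.FG G) (hG : Group.IsVirtuallyNilpotent G) :
    Group.IsVirtuallyNilpotent (SidkiDouble G) := by
  obtain ⟨K, hK, hKi⟩ := hG
  let H := K.normalCore
  have hHi : H.FiniteIndex := Subgroup.finiteIndex_normalCore K
  have hHn : Group.IsNilpotent H :=
    Group.nilpotent_of_mulEquiv (Subgroup.subgroupOfEquivOfLe K.normalCore_le)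
  let φ : SidkiDouble G →* G × G × G := fold.prod (left.prod right)
  let N := (H.prod (H.prod H)).comap φ
  let W := (fold (G := G)).ker ⊓ (left.ker ⊓ right.ker)
  obtain ⟨c, hc⟩ := (Subgroup.isNilpotent_iff_lowerCentralSeries H).mp hHn
  have hNW : N.lowerCentralSeries c ≤ W := by
    have h1 : (N.lowerCentralSeries c).map φ ≤ ⊥ := by
      rw [Subgroup.map_lowerCentralSeries]
      refine (Subgroup.lowerCentralSeries_mono c (Subgroup.map_comap_le φ _)).trans ?_
      simp only [Subgroup.lowerCentralSeries_prod, hc, Subgroup.bot_prod_bot, le_refl]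
    intro x hx
    have h2 : φ x = 1 := h1 ⟨x, hx, rfl⟩
    simp only [φ, Prod.ext_iff, MonoidHom.prod_apply, Prod.fst_one, Prod.snd_one] at h2
    exact h2
  have hW : ∀ w ∈ W, ∀ l ∈ (fold (G := G)).ker, Commute l w :=
    fun w hw l hl => commute_of_mem_ker hl hw.2.1 hw.2.2
  have hconj' : ∀ w x y : SidkiDouble G, Commute (y⁻¹ * x) w → x * w * x⁻¹ = y * w * y⁻¹ := by
    intro w x y h
    calc x * w * x⁻¹ = y * (y⁻¹ * x * w) * x⁻¹ := by group
      _ = y * w * y⁻¹ := by rw [h.eq]; group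
  have hconj : ∀ w ∈ W, ∀ x y : SidkiDouble G, fold x = fold y → x * w * x⁻¹ = y * w * y⁻¹ :=
    fun w hw x y hxy => hconj' w x y (hW w hw _ (by simp [MonoidHom.mem_ker, hxy]))
  have hcomm : ∀ w ∈ W, ∀ a b : G, inl (a * b) * w * (inl (a * b))⁻¹ =
      inl (b * a) * w * (inl (b * a))⁻¹ := by
    intro w hw a b
    -- Only the image under `fold` matters, so `b` may be taken from the second copy; the two orders
    -- then differ by an element killed by `left` and `right`.
    rw [hconj w hw (inl (a * b)) (inl a * inr b) (by simp),
      hconj w hw (inl (b * a)) (inr b * inl a) (by simp)]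
    exact hconj' _ _ _ (commute_of_mem_ker hw.1 (by simp) (by simp)).symm
  have hNi : N.FiniteIndex := ⟨by
    rw [Subgroup.index_comap]
    have : (H.prod (H.prod H)).FiniteIndex := ⟨by
      simp [Subgroup.index_prod, Subgroup.FiniteIndex.index_ne_zero]⟩
    exact Subgroup.FiniteIndex.index_ne_zero (H := (H.prod (H.prod H)).subgroupOf φ.range)⟩
  refine ⟨N, ?_, hNi⟩
  have : Group.FG H := Subgroup.fg_of_index_ne_zero H
  refine Subgroup.isNilpotent_of_unipotent_action this (inl.comp H.subtype) W
    (fun a ha b hb => (hW b hb a ha.1).eq) N c hNW ?_ (fun a b w hw => hcomm w hw a b)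
    (fun h => exists_iterate_commutator_inl_eq_one H h.2)
  intro x hx
  exact ⟨⟨fold x, hx.1⟩, fun w hw => hconj w hw _ _ rfl⟩

end

end SidkiDouble

/-- If `G` is finitely generated and virtually nilpotent, then its Sidki double is virtually
nilpotent. -/
theorem theoremD (G : Type*) [Group G] (hfg : Group.FG G)
    (hG : Group.IsVirtuallyNilpotent G) :
    Group.IsVirtuallyNilpotent (SidkiDouble G) := by
  exact SidkiDouble.isVirtuallyNilpotent hfg hG
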